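/- A \emph{comparator circuit} over a set of Boolean variables consists of finitely many wires, each labelled by a literal (a variable or its negation), a sequence of gates, each an ordered pair of wires, and an output wire. A gate $(u,v)$ replaces the values on $u$ and $v$ by their conjunction (on $u$) and their disjunction (on $v$); each wire starts with the value of its literal, and the final value of the output wire is the value of the circuit. Let $\ell(f)$ be the minimum number of wires of a comparator circuit that computes $f$ (with $\ell(f):=0$ if $f$ is a function of no variables). For $\sigma,\beta\in\{0,1\}^n$ and $f:\{0,1\}^n\to\{0,1\}$, let $f|_{(\sigma,\beta)}$ be the function of the variables $x_i$ with $\sigma(i)=1$ obtained from $f$ by fixing each $x_i$ with $\sigma(i)=0$ to $\beta(i)$. All logarithms are to base $2$. For all constants $c>0$ and $\varepsilon>0$ there is a constant $A$, depending only on $c$ and $\varepsilon$, such that the following holds. Let $n\ge 1$, let $f:\{0,1\}^n\to\{0,1\}$ and $\ell:=\ell(f)$, suppose that $\ell\ge n^{\varepsilon}$, and let $p:=2^{-\lceil \frac23\log \ell\rceil}$, that is, $\ell^{-2/3}$ rounded down to a power of $\frac12$. Then there are an integer $0\le r\le A(\log\ell+1)^A$ and a map $D:\{0,1\}^r\to\{0,1\}^n$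 (a pseudorandom selection $\sigma=D(z)$, sampled with a uniformly random seed $z$ of $r$ bits) such that: 1. $D$ is $p$-regular: $\Pr_{z\in\{0,1\}^r}[D(z)_i=1]=p$ for every $i\in[n]$. 2. For independent uniformly random $z\in\{0,1\}^r$ and $\beta\in\{0,1\}^n$, $$\Pr_{z,\beta}\left[\ell\bigl(f|_{(D(z),\beta)}\bigr)\ \ge\ 2^{3\sqrt{c\log\ell}}\cdot p\,\ell\right]\ \le\ 2\,\ell^{-c}.$$ 3. There is a Boolean circuit (with constant, NOT, and fan-in-two AND and OR gates) with at most $A(\log\ell+1)^A$ gates that, given the $\lceil\log n\rceil$-bit binary representation of an index $j\in\{0,\dots,n-1\}$ and a seed $z\in\{0,1\}^r$, outputs the $j$-th coordinate of $D(z)$ (coordinates numbered from $0$). -/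

import Mathlib

/-! ### Comparator circuits -/

/-- A comparator circuit over the set `V` of variables: wires `0, …, wires - 1`, each labelled by a
literal (`(x, true)` is the variable `x`, `(x, false)` is its negation), a sequence of gates, which
are ordered pairs of wires, and an output wire. -/
structure ComparatorCircuit (V : Type) where
  wires : ℕ
  label : Fin wires → V × Bool
  gates : List (Fin wires × Fin wires)
  output : Fin wires

namespace ComparatorCircuit

variable {V : Type}

/-- The gate `(i, j)` writes the conjunction of the two wires on wire `i` and their disjunction on
wire `j`. (A degenerate gate `(i, i)` does nothing.) -/
def applyGate {m : ℕ} (v : Fin m → Bool) (g : Fin m × Fin m) : Fin m → Bool :=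
  Function.update (Function.update v g.1 (v g.1 && v g.2)) g.2 (v g.1 || v g.2)

/-- The initial values of the wires: `a x` on a wire labelled `x`, and `¬ a x` on a wire
labelled `¬ x`. -/
def initial (C : ComparatorCircuit V) (a : V → Bool) (w : Fin C.wires) : Bool :=
  if (C.label w).2 then a (C.label w).1 else !(a (C.label w).1)

/-- The Boolean function that the circuit computes. -/
def eval (C : ComparatorCircuit V) (a : V → Bool) : Bool :=
  C.gates.foldl applyGate (C.initial a) C.output

end ComparatorCircuit

/-- `ℓ(f)`: the minimum number of wires in a comparator circuit that computes `f`. Every function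
of at least one variable is computed by some comparator circuit; over the empty set of variables
there are no literals, hence no circuits, and the value is `0`. -/
noncomputable def wireComplexity {V : Type} (f : (V → Bool) → Bool) : ℕ :=
  sInf {m : ℕ | ∃ C : ComparatorCircuit V, C.wires = m ∧ C.eval = f}

/-! ### Restrictions and selections -/

/-- A restriction `ρ ∈ {0,1,*}^V`; the value `none` stands for `*`. -/
abbrev Restriction (V : Type) : Type := V → Option Bool

/-- The restriction described by the pair `(σ, β)`: the coordinates with `σ i = 1` are left free,
the other ones are set according to `β`. -/
def Restriction.ofPair {V : Type} (σ β : V → Bool) : Restriction V :=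
  fun i => if σ i then none else some (β i)

/-- The restricted function, a function of the variables in `ρ⁻¹(*)` only. -/
def restrict {V : Type} (f : (V → Bool) → Bool) (ρ : Restriction V) :
    ({i : V // ρ i = none} → Bool) → Bool :=
  fun y => f fun i =>
    match h : ρ i with
    | none => y ⟨i, h⟩
    | some b => b

open Classical in
/-- The probability of the event `E` under the uniform distribution on the finite set `Ω`. -/
noncomputable def uniformProb {Ω : Type} [Fintype Ω] (E : Ω → Prop) : ℝ :=
  ((Finset.univ.filter E).card : ℝ) / (Fintype.card Ω : ℝ)

/-- A random selection over `n` variables that is sampled with `r` uniform random bits, given by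
the map from seeds to selections, is `p`-regular if each coordinate is `1` with probability `p`. -/
def IsRegularSelection {r n : ℕ} (p : ℝ) (D : (Fin r → Bool) → Fin n → Bool) : Prop :=
  ∀ i : Fin n, uniformProb (fun z : Fin r → Bool => D z i = true) = p

/-- `ℓ^(-2/3)` rounded down to a power of `1/2`. -/
noncomputable def selectionRate (l : ℕ) : ℝ :=
  (1 / 2 : ℝ) ^ ⌈(2 / 3 : ℝ) * Real.logb 2 (l : ℝ)⌉₊

/-! ### General Boolean circuits -/

/-- A gate of fan-in at most two whose inputs are taken from the set `W` of nodes. -/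
inductive BooleanGate (W : Type) : Type
  | const (b : Bool) : BooleanGate W
  | not (u : W) : BooleanGate W
  | and (u v : W) : BooleanGate W
  | or (u v : W) : BooleanGate W

/-- The value of a gate, given the values of the nodes. -/
def BooleanGate.eval {W : Type} (g : BooleanGate W) (a : W → Bool) : Bool :=
  match g with
  | .const b => b
  | .not u => !(a u)
  | .and u v => a u && a v
  | .or u v => a u || a v

/-- A sequence of `s` gates over the inputs `V`; the inputs of each gate are among `V` and the
earlier gates, with unbounded fan-out. -/
inductive GateSequence (V : Type) : ℕ → Type
  | nil : GateSequence V 0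
  | snoc {s : ℕ} (P : GateSequence V s) (g : BooleanGate (V ⊕ Fin s)) : GateSequence V (s + 1)

/-- The values of all the gates. -/
def GateSequence.eval {V : Type} (a : V → Bool) : {s : ℕ} → GateSequence V s → Fin s → Bool
  | _, .nil => Fin.elim0
  | _, .snoc P g => Fin.snoc (α := fun _ => Bool) (P.eval a) (g.eval (Sum.elim a (P.eval a)))

/-- A Boolean circuit over the inputs `V`; its size is the number of its gates. -/
structure BooleanCircuit (V : Type) where
  size : ℕ
  gates : GateSequence V size
  output : V ⊕ Fin size

/-- The Boolean function that the circuit computes. -/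
def BooleanCircuit.eval {V : Type} (C : BooleanCircuit V) (a : V → Bool) : Bool :=
  Sum.elim a (C.gates.eval a) C.output

/-- The index `j < n`, written in binary with `⌈log₂ n⌉` bits (bit `0` is the least significant). -/
def indexBits {n : ℕ} (j : Fin n) : Fin (Nat.clog 2 n) → Bool :=
  fun i => Nat.testBit (j : ℕ) (i : ℕ)

/-! Write `X = √(c log ℓ)`, so that `2^(-X²) = ℓ^(-c)`, and fix an optimal circuit; the weight of a
variable is the number of wires it labels. Fixing variables kills their wires: a gate with a
constant input acts as the identity or as a swap, so the restricted function needs no more wires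
than the live weight (`sizeLE_subst`), up to the two wires that a constant may need.

The live weight alone does not concentrate, since a few variables may be very heavy. Call a variable
heavy if its weight is at least `M = 2^X pℓ`. There are at most `ℓ/M` heavy variables, so on average
at most `2^(-X)` of them stay alive, and the light live weight averages at most `pℓ = 2^(-X) M`. By
a moment bound of order `⌈X⌉` (`uniformProb_weight_le`), each of the events "at least `⌈X⌉` live
heavy variables" and "light live weight at least `⌈X⌉ M`" has probability at most `2^(-X²)`. Outside
both, Shannon expansion along the live heavy variables gives fewer than `2^X · 2^X · 2^X pℓ` wires,
whatever `β` is.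

The moment bound needs only `κ`-wise independence with `κ = ⌈X⌉ + 1`. It is supplied by a random
polynomial with `κ` coefficients over a field with `2^m` elements: index `j` is selected when the
first `K` bits of the value at `j` vanish, where `p = 2^(-K)`. As `ℓ ≥ n^ε`, one may take `m = O(log
ℓ)`, and Horner's rule evaluates the selection by a small circuit. -/

/-! ### Comparator circuits: substitution, composition and expansion -/

namespace ComparatorCircuit

theorem applyGate_self {m : ℕ} (v : Fin m → Bool) (u : Fin m) : applyGate v (u, u) = v := by
  simp [applyGate]

theorem applyGate_eq_swap {m : ℕ} (v : Fin m → Bool) {a b : Fin m} (hab : a ≠ b)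
    (h : v a = true ∨ v b = false) : applyGate v (a, b) = v ∘ Equiv.swap a b := by
  funext w
  simp only [applyGate, Function.comp]
  by_cases hb : w = b
  · subst hb
    rw [Function.update_self, Equiv.swap_apply_right]
    rcases h with h | h <;> simp [h]
  · rw [Function.update_of_ne hb]
    by_cases ha : w = a
    · subst ha
      rw [Function.update_self, Equiv.swap_apply_left]
      rcases h with h | h <;> simp [h]
    · rw [Function.update_of_ne ha, Equiv.swap_apply_of_ne_of_ne ha hb]

theorem applyGate_eq_id {m : ℕ} (v : Fin m → Bool) {a b : Fin m}
    (h : v a = false ∨ v b = true) : applyGate v (a, b) = v := by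
  funext w
  simp only [applyGate]
  by_cases hb : w = b
  · subst hb
    rw [Function.update_self]
    rcases h with h | h <;> simp [h]
  · rw [Function.update_of_ne hb]
    by_cases ha : w = a
    · subst ha
      rw [Function.update_self]
      rcases h with h | h <;> simp [h]
    · rw [Function.update_of_ne ha]

/-- One gate acting on wires that carry constants or the values of `m'` other wires can be
replaced by at most one gate on the latter. -/
theorem exists_applyGate_subst {m m' : ℕ} (g : Fin m × Fin m) (φ : Fin m → Fin m' ⊕ Bool)
    (hφ : ∀ u v a, φ u = Sum.inl a → φ v = Sum.inl a → u = v) :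
    ∃ (gs : List (Fin m' × Fin m')) (ψ : Fin m → Fin m' ⊕ Bool),
      (∀ u v a, ψ u = Sum.inl a → ψ v = Sum.inl a → u = v) ∧
      ∀ x : Fin m' → Bool, applyGate (fun w => Sum.elim x id (φ w)) g =
        fun w => Sum.elim (gs.foldl applyGate x) id (ψ w) := by
  obtain ⟨u, v⟩ := g
  by_cases huv : u = v
  · subst huv
    exact ⟨[], φ, hφ, fun x => applyGate_self _ _⟩
  -- A swap of the two wires needs no gate: it is absorbed into the bookkeeping map.
  have hswap : (∀ x : Fin m' → Bool, Sum.elim x id (φ u) = true ∨ Sum.elim x id (φ v) = false) →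
      ∃ (gs : List (Fin m' × Fin m')) (ψ : Fin m → Fin m' ⊕ Bool),
      (∀ u v a, ψ u = Sum.inl a → ψ v = Sum.inl a → u = v) ∧
      ∀ x : Fin m' → Bool, applyGate (fun w => Sum.elim x id (φ w)) (u, v) =
        fun w => Sum.elim (gs.foldl applyGate x) id (ψ w) := fun h =>
    ⟨[], φ ∘ Equiv.swap u v,
      fun a b c ha hb => (Equiv.swap u v).injective (hφ _ _ c ha hb),
      fun x => applyGate_eq_swap _ huv (h x)⟩
  have hid : (∀ x : Fin m' → Bool, Sum.elim x id (φ u) = false ∨ Sum.elim x id (φ v) = true) →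
      ∃ (gs : List (Fin m' × Fin m')) (ψ : Fin m → Fin m' ⊕ Bool),
      (∀ u v a, ψ u = Sum.inl a → ψ v = Sum.inl a → u = v) ∧
      ∀ x : Fin m' → Bool, applyGate (fun w => Sum.elim x id (φ w)) (u, v) =
        fun w => Sum.elim (gs.foldl applyGate x) id (ψ w) := fun h =>
    ⟨[], φ, hφ, fun x => applyGate_eq_id _ (h x)⟩
  rcases hu : φ u with a | (_ | _)
  · rcases hv : φ v with b | (_ | _)
    -- Only two non-constant wires require a real gate; injectivity of `φ` on such wires ensures
    -- that no other wire sees its effect.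
    · refine ⟨[(a, b)], φ, hφ, fun x => funext fun w => ?_⟩
      simp only [List.foldl_cons, List.foldl_nil, applyGate]
      by_cases hwv : w = v
      · subst hwv
        simp [hv, hu]
      · rw [Function.update_of_ne hwv]
        by_cases hwu : w = u
        · subst hwu
          have hab : a ≠ b := fun h => huv (hφ _ _ a hu (by rw [hv, h]))
          simp [hv, hu, Function.update_of_ne hab]
        · rw [Function.update_of_ne hwu]
          rcases hw : φ w with d | d
          · have hdb : d ≠ b := fun h => hwv (hφ _ _ b (by rw [hw, h]) hv)
            have hda : d ≠ a := fun h => hwu (hφ _ _ a (by rw [hw, h]) hu)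
            simp [Function.update_of_ne hdb, Function.update_of_ne hda]
          · simp
    · exact hswap fun x => by simp [hv]
    · exact hid fun x => by simp [hv]
  · exact hid fun x => by simp [hu]
  · exact hswap fun x => by simp [hu]

theorem exists_foldl_subst {m m' : ℕ} (gates : List (Fin m × Fin m)) :
    ∀ φ : Fin m → Fin m' ⊕ Bool, (∀ u v a, φ u = Sum.inl a → φ v = Sum.inl a → u = v) →
    ∃ (gs : List (Fin m' × Fin m')) (ψ : Fin m → Fin m' ⊕ Bool),
      ∀ x : Fin m' → Bool, gates.foldl applyGate (fun w => Sum.elim x id (φ w)) =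
        fun w => Sum.elim (gs.foldl applyGate x) id (ψ w) := by
  induction gates with
  | nil => exact fun φ _ => ⟨[], φ, fun x => rfl⟩
  | cons g gates ih =>
    intro φ hφ
    obtain ⟨gs, ψ, hψ, h⟩ := exists_applyGate_subst g φ hφ
    obtain ⟨gs', ψ', h'⟩ := ih ψ hψ
    refine ⟨gs ++ gs', ψ', fun x => ?_⟩
    rw [List.foldl_cons, h, h', List.foldl_append]

/-! ### Parallel composition of comparator circuits and Shannon expansion. -/

theorem foldl_append_left {m m' : ℕ} (gates : List (Fin m × Fin m)) :
    ∀ (x : Fin m → Bool) (y : Fin m' → Bool),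
    (gates.map (Prod.map (Fin.castAdd m') (Fin.castAdd m'))).foldl applyGate (Fin.append x y) =
      Fin.append (gates.foldl applyGate x) y := by
  induction gates with
  | nil => exact fun _ _ => rfl
  | cons g gates ih =>
    intro x y
    rw [List.map_cons, List.foldl_cons, List.foldl_cons, ← ih]
    congr 1
    obtain ⟨u, v⟩ := g
    funext w
    refine Fin.addCases (fun w => ?_) (fun w => ?_) w
    · simp [applyGate, Function.update_apply]
    · have h (a : Fin m) : Fin.natAdd m w ≠ Fin.castAdd m' a := by
        intro h; have := congrArg Fin.val h; simp at this; omega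
      simp [applyGate, h]

theorem foldl_append_right {m m' : ℕ} (gates : List (Fin m' × Fin m')) :
    ∀ (x : Fin m → Bool) (y : Fin m' → Bool),
    (gates.map (Prod.map (Fin.natAdd m) (Fin.natAdd m))).foldl applyGate (Fin.append x y) =
      Fin.append x (gates.foldl applyGate y) := by
  induction gates with
  | nil => exact fun _ _ => rfl
  | cons g gates ih =>
    intro x y
    rw [List.map_cons, List.foldl_cons, List.foldl_cons, ← ih]
    congr 1
    obtain ⟨u, v⟩ := g
    funext w
    refine Fin.addCases (fun w => ?_) (fun w => ?_) w
    · have h (a : Fin m') : Fin.castAdd m' w ≠ Fin.natAdd m a := by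
        intro h; have := congrArg Fin.val h; simp at this; omega
      simp [applyGate, h]
    · simp [applyGate, Function.update_apply]

variable {V V' : Type}

/-- Two circuits side by side, followed by a gate that joins their outputs; `b` tells whether the
conjunction or the disjunction is the output. -/
def join (C C' : ComparatorCircuit V) (b : Bool) : ComparatorCircuit V where
  wires := C.wires + C'.wires
  label := Fin.append C.label C'.label
  gates := C.gates.map (Prod.map (Fin.castAdd _) (Fin.castAdd _)) ++
    C'.gates.map (Prod.map (Fin.natAdd _) (Fin.natAdd _)) ++
    [(Fin.castAdd _ C.output, Fin.natAdd _ C'.output)]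
  output := if b then Fin.castAdd _ C.output else Fin.natAdd _ C'.output

theorem join_eval (C C' : ComparatorCircuit V) (b : Bool) (a : V → Bool) :
    (C.join C' b).eval a = if b then (C.eval a && C'.eval a) else (C.eval a || C'.eval a) := by
  have hinit : (C.join C' b).initial a = Fin.append (C.initial a) (C'.initial a) := by
    funext w
    change Fin (C.wires + C'.wires) at w
    refine Fin.addCases (fun w => ?_) (fun w => ?_) w <;> simp [initial, join]
  have hne : Fin.castAdd C'.wires C.output ≠ Fin.natAdd C.wires C'.output := by
    intro h; have := congrArg Fin.val h; simp at this; omega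
  unfold eval
  rw [hinit]
  simp only [join, List.foldl_append, List.foldl_cons, List.foldl_nil, foldl_append_left,
    foldl_append_right]
  cases b <;> simp [applyGate, Function.update_of_ne hne]

/-- `f` is constant or computed by a comparator circuit with at most `m` wires. -/
def SizeLE (f : (V → Bool) → Bool) (m : ℕ) : Prop :=
  (∃ b, f = fun _ => b) ∨ ∃ C : ComparatorCircuit V, C.wires ≤ m ∧ C.eval = f

theorem SizeLE.mono {f : (V → Bool) → Bool} {m m' : ℕ} (h : SizeLE f m) (hm : m ≤ m') :
    SizeLE f m' :=
  h.imp_right fun ⟨C, hC, e⟩ => ⟨C, hC.trans hm, e⟩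

theorem sizeLE_literal (x : V) (b : Bool) : SizeLE (fun a => if b then a x else !(a x)) 1 :=
  Or.inr ⟨⟨1, fun _ => (x, b), [], 0⟩, le_rfl, rfl⟩

/-- A constant operand is absorbed without any wire, so sizes add in all cases; this is why `SizeLE`
admits constants. -/
theorem SizeLE.and {f g : (V → Bool) → Bool} {m m' : ℕ} (hf : SizeLE f m) (hg : SizeLE g m') :
    SizeLE (fun a => f a && g a) (m + m') := by
  rcases hf with ⟨b, rfl⟩ | ⟨C, hC, rfl⟩
  · cases b
    · exact Or.inl ⟨false, by simp⟩
    · simpa using hg.mono (Nat.le_add_left _ _)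
  · rcases hg with ⟨b, rfl⟩ | ⟨C', hC', rfl⟩
    · cases b
      · exact Or.inl ⟨false, by simp⟩
      · exact Or.inr ⟨C, by omega, by simp⟩
    · exact Or.inr ⟨C.join C' true, Nat.add_le_add hC hC', funext fun a => by simp [join_eval]⟩

theorem SizeLE.or {f g : (V → Bool) → Bool} {m m' : ℕ} (hf : SizeLE f m) (hg : SizeLE g m') :
    SizeLE (fun a => f a || g a) (m + m') := by
  rcases hf with ⟨b, rfl⟩ | ⟨C, hC, rfl⟩
  · cases b
    · simpa using hg.mono (Nat.le_add_left _ _)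
    · exact Or.inl ⟨true, by simp⟩
  · rcases hg with ⟨b, rfl⟩ | ⟨C', hC', rfl⟩
    · cases b
      · exact Or.inr ⟨C, by omega, by simp⟩
      · exact Or.inl ⟨true, by simp⟩
    · exact Or.inr ⟨C.join C' false, Nat.add_le_add hC hC', funext fun a => by simp [join_eval]⟩

/-- Shannon expansion along the variable `x`. -/
theorem SizeLE.expand [DecidableEq V] {f : (V → Bool) → Bool} {m : ℕ} (x : V)
    (h : ∀ b, SizeLE (fun a => f (Function.update a x b)) m) : SizeLE f (2 * m + 2) := by
  -- `f = (x ∧ f|ₓ₌₁) ∨ (¬x ∧ f|ₓ₌₀)`: two cofactors and two literal wires.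
  have := ((sizeLE_literal x true).and (h true)).or ((sizeLE_literal x false).and (h false))
  convert this.mono (show 1 + m + (1 + m) ≤ 2 * m + 2 by omega) using 1
  funext a
  have ha : f a = f (Function.update a x (a x)) := by rw [Function.update_eq_self]
  cases hx : a x <;> rw [ha, hx] <;> simp

/-- Shannon expansion along all the variables in `H`. -/
theorem SizeLE.expand_finset [DecidableEq V] {m : ℕ} (H : Finset V) :
    ∀ f : (V → Bool) → Bool,
      (∀ a : V → Bool, SizeLE (fun y => f fun i => if i ∈ H then a i else y i) m) →
      ∃ t, t + 2 = 2 ^ H.card * (m + 2) ∧ SizeLE f t := by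
  induction H using Finset.induction_on with
  | empty => exact fun f h => ⟨m, by simp, by simpa using h fun _ => true⟩
  | insert x H hx ih =>
    intro f h
    -- The recursion `t ↦ 2t + 2` doubles `t + 2`, whence the closed form.
    refine ⟨2 * (2 ^ H.card * (m + 2) - 2) + 2, ?_, SizeLE.expand x fun b => ?_⟩
    · rw [Finset.card_insert_of_notMem hx, pow_succ]
      have : 1 ≤ 2 ^ H.card := Nat.one_le_two_pow
      have : 1 * (m + 2) ≤ 2 ^ H.card * (m + 2) := Nat.mul_le_mul_right _ this
      have : 2 ^ H.card * 2 * (m + 2) = 2 * (2 ^ H.card * (m + 2)) := by ring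
      omega
    · obtain ⟨t, ht, hf⟩ := ih (fun a => f (Function.update a x b)) fun a => by
        convert h (Function.update a x b) using 4 with y
        rename_i i
        by_cases hi : i = x
        · subst hi; simp
        · simp [hi]
      rwa [show 2 ^ H.card * (m + 2) - 2 = t by omega]

/-- Substituting constants for some of the variables leaves only the wires labelled by the
remaining ones. -/
theorem sizeLE_subst (C : ComparatorCircuit V) (s : V → V' ⊕ Bool) :
    SizeLE (fun y : V' → Bool => C.eval fun i => Sum.elim y id (s i))
      (Finset.univ.filter fun w => (s (C.label w).1).isLeft).card := by
  classical
  set N := Finset.univ.filter fun w => (s (C.label w).1).isLeft with hN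
  have hmem (w) : w ∈ N ↔ (s (C.label w).1).isLeft := by simp [hN]
  let e := N.equivFin
  -- Surviving wires are renumbered; every other wire starts with a constant.
  let φ : Fin C.wires → Fin N.card ⊕ Bool := fun w =>
    if hw : w ∈ N then Sum.inl (e ⟨w, hw⟩)
    else Sum.inr (Sum.elim (fun _ => false)
      (fun b => if (C.label w).2 then b else !b) (s (C.label w).1))
  have hφ : ∀ u v a, φ u = Sum.inl a → φ v = Sum.inl a → u = v := by
    intro u v a hu hv
    by_cases hu' : u ∈ N
    · by_cases hv' : v ∈ N
      · simp only [φ, hu', hv', dif_pos, Sum.inl.injEq] at hu hv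
        simpa using e.injective (hu.trans hv.symm)
      · simp [φ, hv'] at hv
    · simp [φ, hu'] at hu
  obtain ⟨gs, ψ, h⟩ := exists_foldl_subst C.gates φ hφ
  let lab : Fin N.card → V' × Bool := fun k =>
    ((s (C.label (e.symm k)).1).getLeft ((hmem _).1 (e.symm k).2), (C.label (e.symm k)).2)
  let I (y : V' → Bool) (k : Fin N.card) : Bool := if (lab k).2 then y (lab k).1 else !y (lab k).1
  have hinit (y : V' → Bool) :
      C.initial (fun i => Sum.elim y id (s i)) = fun w => Sum.elim (I y) id (φ w) := by
    funext w
    by_cases hw : w ∈ N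
    · obtain ⟨x, hx⟩ := Sum.isLeft_iff.1 ((hmem w).1 hw)
      simp [initial, φ, hw, I, lab, hx]
    · rcases hx : s (C.label w).1 with x | b
      · exact absurd ((hmem w).2 (by simp [hx])) hw
      · simp [initial, φ, hw, hx]
  have heval (y : V' → Bool) : C.eval (fun i => Sum.elim y id (s i)) =
      Sum.elim (gs.foldl applyGate (I y)) id (ψ C.output) := by
    rw [eval, hinit, h]
  simp only [heval]
  rcases ho : ψ C.output with o | b
  · exact Or.inr ⟨⟨N.card, lab, gs, o⟩, le_rfl, rfl⟩
  · exact Or.inl ⟨b, rfl⟩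

/-! ### Wire complexity of restricted functions. -/

theorem SizeLE.wireComplexity_le {f : (V → Bool) → Bool} {m : ℕ} (h : SizeLE f m) :
    wireComplexity f ≤ max 2 m := by
  rcases h with ⟨b, rfl⟩ | ⟨C, hC, rfl⟩
  -- A constant is `x ∧ ¬x` or `x ∨ ¬x`, on two wires; without variables the infimum of the empty
  -- set is `0`.
  · refine le_max_of_le_left ?_
    rcases isEmpty_or_nonempty V with hV | ⟨⟨x⟩⟩
    · rw [wireComplexity, Set.eq_empty_of_forall_notMem (s := {m | _}), Nat.sInf_empty]
      · omega
      · rintro m ⟨C, -, -⟩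
        exact hV.elim (C.label C.output).1
    · refine Nat.sInf_le ⟨⟨2, ![(x, true), (x, false)], [(0, 1)], if b then 1 else 0⟩, rfl, ?_⟩
      funext a
      cases b <;> simp [eval, applyGate, initial]
  · exact le_max_of_le_right
      ((show wireComplexity C.eval ≤ C.wires from Nat.sInf_le ⟨C, rfl, rfl⟩).trans hC)

theorem wireComplexity_restrict_le {n : ℕ} (C : ComparatorCircuit (Fin n))
    (ρ : Restriction (Fin n)) :
    wireComplexity (restrict C.eval ρ) ≤
      max 2 (Finset.univ.filter fun w => ρ (C.label w).1 = none).card := by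
  let s : Fin n → {i // ρ i = none} ⊕ Bool := fun i =>
    match h : ρ i with
    | none => Sum.inl ⟨i, h⟩
    | some b => Sum.inr b
  have hs1 (i) (h : ρ i = none) : s i = Sum.inl ⟨i, h⟩ := by
    simp only [s]; split <;> simp_all
  have hs2 (i) (b) (h : ρ i = some b) : s i = Sum.inr b := by
    simp only [s]; split <;> simp_all
  have hs (i) : (s i).isLeft ↔ ρ i = none := by
    simp only [s]; split <;> simp_all
  have h := (sizeLE_subst C s).wireComplexity_le
  simp only [hs] at h
  convert h using 3 with y
  unfold restrict
  congr 1
  funext i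
  split
  next h => rw [hs1 i h]; rfl
  next b h => rw [hs2 i b h]; rfl

/-- The restricted function, expanded along the live variables in `H`. -/
theorem wireComplexity_restrict_le_expand {n : ℕ} (C : ComparatorCircuit (Fin n))
    (ρ : Restriction (Fin n)) (H : Finset (Fin n)) :
    wireComplexity (restrict C.eval ρ) ≤ 2 ^ (H.filter fun i => ρ i = none).card *
      ((Finset.univ.filter fun w => (C.label w).1 ∉ H ∧ ρ (C.label w).1 = none).card + 2) := by
  classical
  set m := (Finset.univ.filter fun w => (C.label w).1 ∉ H ∧ ρ (C.label w).1 = none).card with hm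
  obtain ⟨t, ht, h⟩ := SizeLE.expand_finset (m := m)
    (H.subtype fun i => ρ i = none) (restrict C.eval ρ) fun a => by
      -- Live variables in `H` are fixed by `a`, so only wires with a live label outside `H`
      -- survive.
      let s : Fin n → {i // ρ i = none} ⊕ Bool := fun i =>
        match h : ρ i with
        | none => if i ∈ H then Sum.inr (a ⟨i, h⟩) else Sum.inl ⟨i, h⟩
        | some b => Sum.inr b
      have hs1 (i) (h : ρ i = none) :
          s i = if i ∈ H then Sum.inr (a ⟨i, h⟩) else Sum.inl ⟨i, h⟩ := by
        simp only [s]; split <;> simp_all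
      have hs2 (i) (b) (h : ρ i = some b) : s i = Sum.inr b := by
        simp only [s]; split <;> simp_all
      have hs (i) : (s i).isLeft ↔ i ∉ H ∧ ρ i = none := by
        simp only [s]; split
        · split_ifs <;> simp_all
        · simp_all
      have h := sizeLE_subst C s
      simp only [hs] at h
      convert h using 2 with y
      unfold restrict
      congr 1
      funext i
      split
      next h => rw [hs1 i h]; simp only [Finset.mem_subtype]; split_ifs <;> rfl
      next b h => rw [hs2 i b h]; rfl
  have := h.wireComplexity_le
  rw [Finset.card_subtype] at ht
  have : 1 ≤ 2 ^ (H.filter fun i => ρ i = none).card := Nat.one_le_two_pow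
  have : 1 * (m + 2) ≤ 2 ^ (H.filter fun i => ρ i = none).card * (m + 2) :=
    Nat.mul_le_mul_right _ this
  omega

end ComparatorCircuit

/-! ### Uniform probabilities -/

theorem uniformProb_mul_card {Ω : Type} [Fintype Ω] [Nonempty Ω] (E : Ω → Prop)
    [DecidablePred E] :
    uniformProb E * Fintype.card Ω = ∑ z, if E z then (1 : ℝ) else 0 := by
  have : (Fintype.card Ω : ℝ) ≠ 0 := by exact_mod_cast Fintype.card_ne_zero
  rw [uniformProb, div_mul_cancel₀ _ this, Finset.sum_boole]
  congr!

theorem uniformProb_le_one {Ω : Type} [Fintype Ω] (E : Ω → Prop) : uniformProb E ≤ 1 := by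
  unfold uniformProb
  exact div_le_one_of_le₀ (by exact_mod_cast Finset.card_le_univ _) (by positivity)

theorem uniformProb_mono {Ω : Type} [Fintype Ω] {E E' : Ω → Prop} (h : ∀ z, E z → E' z) :
    uniformProb E ≤ uniformProb E' := by
  unfold uniformProb
  gcongr with z
  exact h z

theorem uniformProb_or_le {Ω : Type} [Fintype Ω] (E E' : Ω → Prop) :
    uniformProb (fun z => E z ∨ E' z) ≤ uniformProb E + uniformProb E' := by
  classical
  unfold uniformProb
  rw [← add_div]
  gcongr
  have h := Finset.card_union_le (Finset.univ.filter E) (Finset.univ.filter E')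
  rw [← Finset.filter_or] at h
  refine le_trans (Nat.cast_le.2 ?_) (Nat.cast_add _ _).le
  convert h

theorem uniformProb_equiv {Ω Ω' : Type} [Fintype Ω] [Fintype Ω'] (e : Ω ≃ Ω') (E : Ω' → Prop) :
    uniformProb (fun z => E (e z)) = uniformProb E := by
  classical
  unfold uniformProb
  rw [Fintype.card_congr e]
  congr 2
  exact Finset.card_bij (fun z _ => e z) (by simp) (by simp)
    fun z hz => ⟨e.symm z, by simpa using hz, by simp⟩

/-- Used to drop `β`: the bad events depend on the seed only. -/
theorem uniformProb_fst {Ω Ω' : Type} [Fintype Ω] [Fintype Ω'] [Nonempty Ω'] (E : Ω → Prop) :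
    uniformProb (fun z : Ω × Ω' => E z.1) = uniformProb E := by
  classical
  have h : Finset.univ.filter (fun z : Ω × Ω' => E z.1) =
      Finset.univ.filter E ×ˢ Finset.univ := by
    ext; simp
  have h0 : (Fintype.card Ω' : ℝ) ≠ 0 := by exact_mod_cast Fintype.card_ne_zero
  unfold uniformProb
  rw [show (Finset.univ.filter (fun z : Ω × Ω' => E z.1)).card = _ from congrArg _ (by convert h),
    Finset.card_product, Fintype.card_prod, Nat.cast_mul, Nat.cast_mul, Finset.card_univ,
    mul_div_mul_right _ _ h0]

/-- The kernel has index `|B|` by the first isomorphism theorem. -/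
theorem uniformProb_eq_zero_of_surjective {A B : Type} [AddGroup A] [AddGroup B] [Fintype A]
    [Fintype B] (T : A →+ B) (hT : Function.Surjective T) :
    uniformProb (fun a => T a = 0) = 1 / Fintype.card B := by
  classical
  have h := T.ker.card_eq_card_quotient_mul_card_addSubgroup
  rw [Nat.card_congr (QuotientAddGroup.quotientKerEquivOfSurjective T hT).toEquiv,
    Nat.card_eq_fintype_card, Nat.card_eq_fintype_card] at h
  have hk : Nat.card T.ker = (Finset.univ.filter fun a => T a = 0).card := by
    rw [Nat.card_eq_fintype_card]
    exact Fintype.card_of_subtype _ (by simp [AddMonoidHom.mem_ker])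
  rw [hk] at h
  have h0 : (Fintype.card A : ℝ) ≠ 0 := by exact_mod_cast Fintype.card_ne_zero
  have h1 : (Fintype.card B : ℝ) ≠ 0 := by exact_mod_cast Fintype.card_ne_zero
  unfold uniformProb
  rw [div_eq_div_iff h0 h1, h]
  push_cast
  rw [mul_comm, one_mul]

/-! ### A tail bound for random selections with limited independence -/

section Tail

variable {Ω ι : Type} [Fintype Ω] [DecidableEq ι]

/-- The sum of the products `w x₁ ⋯ w xₖ` over the sequences of `k` distinct elements of
`G \ Q`. -/
def distinctSum (w : ι → ℝ) (G : Finset ι) : ℕ → Finset ι → ℝ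
  | 0, _ => 1
  | k + 1, Q => ∑ x ∈ G \ Q, w x * distinctSum w G k (insert x Q)

/-- Each chosen element removes at most `M` from the available weight, so at least `c` is left at
each of the `k` choices. The hypothesis says that the weight is at least `c + (k - 1) M`, without
subtraction. -/
theorem pow_le_distinctSum {w : ι → ℝ} {G : Finset ι} {M c : ℝ} (hw : ∀ i, 0 ≤ w i)
    (hM : ∀ i ∈ G, w i ≤ M) (hM0 : 0 ≤ M) (hc : 0 ≤ c) (k : ℕ) :
    ∀ Q : Finset ι, c + k * M ≤ ∑ i ∈ G \ Q, w i + M → c ^ k ≤ distinctSum w G k Q := by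
  induction k with
  | zero => intro Q _; simp [distinctSum]
  | succ k ih =>
    intro Q h
    push_cast at h
    have hS : c ≤ ∑ i ∈ G \ Q, w i := by
      have : 0 ≤ (k : ℝ) * M := by positivity
      linarith
    calc c ^ (k + 1) = c * c ^ k := pow_succ' _ _
      _ ≤ (∑ i ∈ G \ Q, w i) * c ^ k := by gcongr
      _ = ∑ i ∈ G \ Q, w i * c ^ k := Finset.sum_mul _ _ _
      _ ≤ distinctSum w G (k + 1) Q := Finset.sum_le_sum fun x hx =>
        mul_le_mul_of_nonneg_left (ih _ ?_) (hw x)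
    have h1 : G \ insert x Q = (G \ Q).erase x := by
      ext; simp only [Finset.mem_sdiff, Finset.mem_insert, Finset.mem_erase]; tauto
    have h2 := Finset.add_sum_erase _ w hx
    have h3 := hM x (Finset.mem_sdiff.1 hx).1
    rw [h1]
    linarith

variable {D : Ω → ι → Bool} {p : ℝ} {κ : ℕ}

/-- Each chosen `x` moves into the set `Q` required to be selected. After `k` choices that set has
`|Q| + k ≤ κ` elements, since the choices are distinct, and limited independence applies. -/
theorem sum_distinctSum_le [Nonempty Ω] {w : ι → ℝ} (hw : ∀ i, 0 ≤ w i) (hp : 0 ≤ p)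
    (hD : ∀ S : Finset ι, S.card ≤ κ →
      uniformProb (fun z => ∀ i ∈ S, D z i = true) ≤ p ^ S.card)
    (U : Finset ι) (k : ℕ) :
    ∀ Q : Finset ι, Q.card + k ≤ κ →
      ∑ z, (if ∀ i ∈ Q, D z i = true then (1 : ℝ) else 0) *
          distinctSum w (U.filter fun i => D z i = true) k Q ≤
        p ^ (Q.card + k) * (∑ i ∈ U, w i) ^ k * Fintype.card Ω := by
  induction k with
  | zero =>
    intro Q hQ
    simp only [distinctSum, mul_one, add_zero, pow_zero]
    rw [← uniformProb_mul_card]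
    exact mul_le_mul_of_nonneg_right (hD Q hQ) (by positivity)
  | succ k ih =>
    intro Q hQ
    have hz (z : Ω) : (if ∀ i ∈ Q, D z i = true then (1 : ℝ) else 0) *
        distinctSum w (U.filter fun i => D z i = true) (k + 1) Q =
        ∑ x ∈ U \ Q, w x * ((if ∀ i ∈ insert x Q, D z i = true then (1 : ℝ) else 0) *
          distinctSum w (U.filter fun i => D z i = true) k (insert x Q)) := by
      have h1 : (U.filter fun i => D z i = true) \ Q = (U \ Q).filter fun i => D z i = true := by
        ext; simp only [Finset.mem_sdiff, Finset.mem_filter]; tauto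
      rw [distinctSum, h1, Finset.sum_filter, Finset.mul_sum]
      refine Finset.sum_congr rfl fun x _ => ?_
      simp only [Finset.forall_mem_insert]
      by_cases hx : D z x = true <;> by_cases hq : ∀ i ∈ Q, D z i = true <;> simp [hx, hq]
    simp only [hz]
    rw [Finset.sum_comm]
    calc _ ≤ ∑ x ∈ U \ Q, w x * (p ^ (Q.card + (k + 1)) * (∑ i ∈ U, w i) ^ k *
          Fintype.card Ω) := by
          refine Finset.sum_le_sum fun x hx => ?_
          rw [← Finset.mul_sum]
          have hc : (insert x Q).card = Q.card + 1 :=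
            Finset.card_insert_of_notMem (Finset.mem_sdiff.1 hx).2
          have h := ih (insert x Q) (by omega)
          rw [hc, show Q.card + 1 + k = Q.card + (k + 1) by ring] at h
          exact mul_le_mul_of_nonneg_left h (hw x)
      _ = (∑ x ∈ U \ Q, w x) * (p ^ (Q.card + (k + 1)) * (∑ i ∈ U, w i) ^ k *
          Fintype.card Ω) := (Finset.sum_mul _ _ _).symm
      _ ≤ (∑ x ∈ U, w x) * (p ^ (Q.card + (k + 1)) * (∑ i ∈ U, w i) ^ k *
          Fintype.card Ω) := by
          have h0 : 0 ≤ ∑ i ∈ U, w i := Finset.sum_nonneg fun i _ => hw i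
          refine mul_le_mul_of_nonneg_right ?_ (by positivity)
          exact Finset.sum_le_sum_of_subset_of_nonneg Finset.sdiff_subset fun i _ _ => hw i
      _ = _ := by ring

/-- The `k`-th moment bound for the total weight of the selected elements of `U`. -/
theorem uniformProb_weight_le [Nonempty Ω] {w : ι → ℝ} (hw : ∀ i, 0 ≤ w i) (hp : 0 ≤ p)
    (hD : ∀ S : Finset ι, S.card ≤ κ →
      uniformProb (fun z => ∀ i ∈ S, D z i = true) ≤ p ^ S.card)
    (U : Finset ι) {k : ℕ} (hk : k ≤ κ) {M c : ℝ} (hM : ∀ i ∈ U, w i ≤ M) (hM0 : 0 ≤ M)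
    (hc : 0 < c) :
    uniformProb (fun z => c + k * M ≤ ∑ i ∈ U.filter (fun i => D z i = true), w i + M) ≤
      (p * (∑ i ∈ U, w i) / c) ^ k := by
  classical
  have h1 := sum_distinctSum_le hw hp hD U k ∅ (by simpa using hk)
  simp only [Finset.notMem_empty, false_imp_iff, implies_true, if_true, one_mul,
    Finset.card_empty, zero_add] at h1
  have h2 := uniformProb_mul_card
    (fun z => c + k * M ≤ ∑ i ∈ U.filter (fun i => D z i = true), w i + M)
  -- Markov's inequality for `distinctSum`, which is at least `c ^ k` on the event.
  have h3 : (∑ z, if c + k * M ≤ ∑ i ∈ U.filter (fun i => D z i = true), w i + M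
      then (1 : ℝ) else 0) * c ^ k ≤
      ∑ z, distinctSum w (U.filter fun i => D z i = true) k ∅ := by
    rw [Finset.sum_mul]
    refine Finset.sum_le_sum fun z _ => ?_
    split_ifs with h
    · rw [one_mul]
      refine pow_le_distinctSum hw (fun i hi => hM i (Finset.mem_filter.1 hi).1) hM0 hc.le k ∅ ?_
      simpa using h
    · rw [zero_mul]
      have hnn (k : ℕ) : ∀ Q, 0 ≤ distinctSum w (U.filter fun i => D z i = true) k Q := by
        induction k with
        | zero => intro Q; simp [distinctSum]
        | succ k ih => exact fun Q => Finset.sum_nonneg fun x _ => mul_nonneg (hw x) (ih _)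
      exact hnn k ∅
  have hcard : (0 : ℝ) < Fintype.card Ω := by exact_mod_cast Fintype.card_pos
  rw [← h2] at h3
  rw [div_pow, mul_pow, le_div_iff₀ (pow_pos hc k)]
  refine le_of_mul_le_mul_right ?_ hcard
  linarith

end Tail

/-! ### Polynomial hashing -/

/-- The polynomial with coefficients `a` at the point `x`. -/
def polyHash {F : Type} [Field F] {κ : ℕ} (x : F) (a : Fin κ → F) : F :=
  ∑ i, a i * x ^ (i : ℕ)

theorem exists_polyHash_eq {F : Type} [Field F] {κ : ℕ} (S : Finset F) (hS : S.card ≤ κ)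
    (y : F → F) : ∃ a : Fin κ → F, ∀ x ∈ S, polyHash x a = y x := by
  classical
  let P := Lagrange.interpolate S id y
  have hinj : Set.InjOn (id : F → F) S := Function.injective_id.injOn
  refine ⟨fun i => P.coeff i, fun x hx => ?_⟩
  have hdeg : P.degree < κ :=
    (Lagrange.degree_interpolate_lt y hinj).trans_le (by exact_mod_cast hS)
  have hκ : 0 < κ := (Finset.card_pos.2 ⟨x, hx⟩).trans_le hS
  have hnat : P.natDegree < κ := by
    by_cases h0 : P = 0
    · rwa [h0, Polynomial.natDegree_zero]
    · exact (Polynomial.natDegree_lt_iff_degree_lt h0).2 hdeg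
  have := Polynomial.eval_eq_sum_range' hnat x
  rw [polyHash, Fin.sum_univ_eq_sum_range (fun i => P.coeff i * x ^ i) κ, ← this]
  exact Lagrange.eval_interpolate_at_node y hinj hx

/-- Evaluation at the points of `S` followed by `π` is additive in the coefficients, and onto `G^S`
by Lagrange interpolation. -/
theorem uniformProb_polyHash {F G : Type} [Field F] [Fintype F] [AddGroup G] [Fintype G]
    (π : F →+ G) (hπ : Function.Surjective π) {κ : ℕ} (S : Finset F) (hS : S.card ≤ κ) :
    uniformProb (fun a : Fin κ → F => ∀ x ∈ S, π (polyHash x a) = 0) =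
      (1 / (Fintype.card G : ℝ)) ^ S.card := by
  classical
  let T : (Fin κ → F) →+ (S → G) :=
    { toFun := fun a x => π (polyHash (x : F) a)
      map_zero' := by funext x; simp [polyHash]
      map_add' := fun a b => by
        funext x
        simp [polyHash, add_mul, Finset.sum_add_distrib] }
  have hT : Function.Surjective T := fun g => by
    choose s hs using hπ
    obtain ⟨a, ha⟩ := exists_polyHash_eq S hS fun x => if hx : x ∈ S then s (g ⟨x, hx⟩) else 0
    refine ⟨a, funext fun x => ?_⟩
    change π (polyHash (x : F) a) = g x
    rw [ha x x.2, dif_pos x.2, hs]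
  have h := uniformProb_eq_zero_of_surjective T hT
  rw [Fintype.card_fun, Fintype.card_coe] at h
  push_cast at h
  rw [one_div_pow, ← h]
  congr 1
  funext a
  simp [T, funext_iff]

/-! ### Boolean circuits -/

section Circuits

variable {V : Type}

/-- The functions computed at the inputs and at the gates. -/
def GateSequence.nodes {s : ℕ} (P : GateSequence V s) : Set ((V → Bool) → Bool) :=
  {φ | ∃ u : V ⊕ Fin s, ∀ a, Sum.elim a (P.eval a) u = φ a}

theorem GateSequence.nodes_subset_snoc {s : ℕ} (P : GateSequence V s)
    (g : BooleanGate (V ⊕ Fin s)) : P.nodes ⊆ (P.snoc g).nodes := by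
  rintro φ ⟨u | u, hu⟩
  · exact ⟨Sum.inl u, hu⟩
  · refine ⟨Sum.inr u.castSucc, fun a => ?_⟩
    rw [← hu a]
    simp [GateSequence.eval]

theorem GateSequence.gate_mem_nodes_snoc {s : ℕ} (P : GateSequence V s)
    (g : BooleanGate (V ⊕ Fin s)) :
    (fun a => g.eval (Sum.elim a (P.eval a))) ∈ (P.snoc g).nodes :=
  ⟨Sum.inr (Fin.last s), fun a => by simp [GateSequence.eval]⟩

/-- Every circuit that computes the functions in `Φ` can be extended by at most `s` gates to one
that computes the functions in `Ψ`, too. -/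
def Extends (Φ : Set ((V → Bool) → Bool)) (s : ℕ) (Ψ : Set ((V → Bool) → Bool)) : Prop :=
  ∀ (t : ℕ) (P : GateSequence V t), Φ ⊆ P.nodes →
    ∃ t' ≤ t + s, ∃ P' : GateSequence V t', P.nodes ⊆ P'.nodes ∧ Ψ ⊆ P'.nodes

variable {Φ Φ' Ψ Ψ' : Set ((V → Bool) → Bool)} {s s' : ℕ}

theorem Extends.mono (h : Extends Φ s Ψ) (hΦ : Φ ⊆ Φ') (hs : s ≤ s') (hΨ : Ψ' ⊆ Ψ) :
    Extends Φ' s' Ψ' := fun t P hP => by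
  obtain ⟨t', ht, P', h1, h2⟩ := h t P (hΦ.trans hP)
  exact ⟨t', by omega, P', h1, hΨ.trans h2⟩

theorem extends_of_subset (h : Ψ ⊆ Φ) : Extends Φ 0 Ψ :=
  fun t P hP => ⟨t, le_rfl, P, subset_rfl, h.trans hP⟩

/-- Computed functions remain available, so intermediate results are shared and gate counts merely
add. -/
theorem Extends.trans {Ω : Set ((V → Bool) → Bool)} (h : Extends Φ s Ψ)
    (h' : Extends (Φ ∪ Ψ) s' Ω) : Extends Φ (s + s') Ω := fun t P hP => by
  obtain ⟨t', ht, P', h1, h2⟩ := h t P hP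
  obtain ⟨t'', ht', P'', h3, h4⟩ := h' t' P' (Set.union_subset (hP.trans h1) h2)
  exact ⟨t'', by omega, P'', h1.trans h3, h4⟩

theorem Extends.union (h : Extends Φ s Ψ) (h' : Extends Φ s' Ψ') :
    Extends Φ (s + s') (Ψ ∪ Ψ') := fun t P hP => by
  obtain ⟨t', ht, P', h1, h2⟩ := h t P hP
  obtain ⟨t'', ht', P'', h3, h4⟩ := h' t' P' (hP.trans h1)
  exact ⟨t'', by omega, P'', h1.trans h3, Set.union_subset (h2.trans h3) h4⟩

theorem Extends.finset_range {ι : Type} (I : Finset ι) (ψ : ι → (V → Bool) → Bool)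
    (h : ∀ i ∈ I, Extends Φ s {ψ i}) : Extends Φ (I.card * s) (ψ '' I) := by
  classical
  induction I using Finset.induction_on with
  | empty => simpa using extends_of_subset (Set.empty_subset Φ)
  | insert x I hx ih =>
    rw [Finset.card_insert_of_notMem hx, Finset.coe_insert, Set.image_insert_eq, Set.insert_eq,
      Set.union_comm, Nat.add_mul, one_mul]
    exact (ih fun i hi => h i (Finset.mem_insert_of_mem hi)).union
      (h x (Finset.mem_insert_self _ _))

theorem Extends.range {ι : Type} [Fintype ι] (ψ : ι → (V → Bool) → Bool)
    (h : ∀ i, Extends Φ s {ψ i}) : Extends Φ (Fintype.card ι * s) (Set.range ψ) := by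
  simpa using Extends.finset_range Finset.univ ψ fun i _ => h i

theorem extends_const (b : Bool) : Extends Φ 1 {fun _ => b} := fun t P _ =>
  ⟨t + 1, le_rfl, P.snoc (.const b), P.nodes_subset_snoc _,
    Set.singleton_subset_iff.2 (P.gate_mem_nodes_snoc _)⟩

theorem extends_not {φ : (V → Bool) → Bool} (h : φ ∈ Φ) : Extends Φ 1 {fun a => !(φ a)} :=
  fun t P hP => by
  obtain ⟨u, hu⟩ := hP h
  refine ⟨t + 1, le_rfl, P.snoc (.not u), P.nodes_subset_snoc _, Set.singleton_subset_iff.2 ?_⟩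
  convert P.gate_mem_nodes_snoc (.not u) using 2 with a
  simp [BooleanGate.eval, hu]

theorem extends_and {φ ψ : (V → Bool) → Bool} (h : φ ∈ Φ) (h' : ψ ∈ Φ) :
    Extends Φ 1 {fun a => φ a && ψ a} := fun t P hP => by
  obtain ⟨u, hu⟩ := hP h
  obtain ⟨v, hv⟩ := hP h'
  refine ⟨t + 1, le_rfl, P.snoc (.and u v), P.nodes_subset_snoc _, Set.singleton_subset_iff.2 ?_⟩
  convert P.gate_mem_nodes_snoc (.and u v) using 2 with a
  simp [BooleanGate.eval, hu, hv]

theorem extends_or {φ ψ : (V → Bool) → Bool} (h : φ ∈ Φ) (h' : ψ ∈ Φ) :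
    Extends Φ 1 {fun a => φ a || ψ a} := fun t P hP => by
  obtain ⟨u, hu⟩ := hP h
  obtain ⟨v, hv⟩ := hP h'
  refine ⟨t + 1, le_rfl, P.snoc (.or u v), P.nodes_subset_snoc _, Set.singleton_subset_iff.2 ?_⟩
  convert P.gate_mem_nodes_snoc (.or u v) using 2 with a
  simp [BooleanGate.eval, hu, hv]

theorem extends_xor {φ ψ : (V → Bool) → Bool} (h : φ ∈ Φ) (h' : ψ ∈ Φ) :
    Extends Φ 4 {fun a => xor (φ a) (ψ a)} := by
  have h1 := (extends_or h h').union ((extends_and h h').trans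
    (extends_not (φ := fun a => φ a && ψ a) (by simp)))
  refine (h1.trans (extends_and (φ := fun a => φ a || ψ a) (ψ := fun a => !(φ a && ψ a))
    (by simp) (by simp))).mono subset_rfl le_rfl ?_
  rw [Set.singleton_subset_iff, Set.mem_singleton_iff]
  funext a
  cases φ a <;> cases ψ a <;> rfl

theorem extends_all {ι : Type} (I : Finset ι) (φ : ι → (V → Bool) → Bool) (h : ∀ i ∈ I, φ i ∈ Φ) :
    Extends Φ (I.card + 1) {fun a => decide (∀ i ∈ I, φ i a = true)} := by
  classical
  induction I using Finset.induction_on with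
  | empty => simpa using extends_const (Φ := Φ) true
  | insert x I hx ih =>
    rw [Finset.card_insert_of_notMem hx]
    refine ((ih fun i hi => h i (Finset.mem_insert_of_mem hi)).trans (extends_and (φ := φ x)
      (ψ := fun a => decide (∀ i ∈ I, φ i a = true)) (Or.inl (h x (Finset.mem_insert_self _ _)))
      (by simp))).mono subset_rfl le_rfl ?_
    simp

theorem Extends.exists_circuit {φ : (V → Bool) → Bool} (h : Extends (∅ : Set _) s {φ}) :
    ∃ C : BooleanCircuit V, C.size ≤ s ∧ ∀ a, C.eval a = φ a := by
  obtain ⟨t, ht, P, -, hP⟩ := h 0 .nil (Set.empty_subset _)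
  obtain ⟨u, hu⟩ := Set.singleton_subset_iff.1 hP
  exact ⟨⟨t, P, u⟩, by simpa using ht, hu⟩

theorem extends_input (x : V) : Extends Φ 0 {fun a => a x} := fun t P _ =>
  ⟨t, le_rfl, P, subset_rfl, Set.singleton_subset_iff.2 ⟨Sum.inl x, fun _ => rfl⟩⟩

/-! ### Arithmetic over the field with two elements -/

/-- The Boolean function given by a function with values in the field of two elements. -/
def bitOf (ψ : (V → Bool) → ZMod 2) : (V → Bool) → Bool := fun a => decide (ψ a = 1)

theorem bitOf_mul (φ ψ : (V → Bool) → ZMod 2) :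
    bitOf (fun a => φ a * ψ a) = fun a => bitOf φ a && bitOf ψ a := by
  have h : ∀ x y : ZMod 2, decide (x * y = 1) = (decide (x = 1) && decide (y = 1)) := by decide
  funext a; exact h _ _

theorem bitOf_add (φ ψ : (V → Bool) → ZMod 2) :
    bitOf (fun a => φ a + ψ a) = fun a => xor (bitOf φ a) (bitOf ψ a) := by
  have h : ∀ x y : ZMod 2, decide (x + y = 1) = xor (decide (x = 1)) (decide (y = 1)) := by decide
  funext a; exact h _ _

theorem extends_bitOf_sum {ι : Type} (I : Finset ι) (ψ : ι → (V → Bool) → ZMod 2)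
    (h : ∀ i ∈ I, Extends Φ s {bitOf (ψ i)}) :
    Extends Φ (I.card * (s + 4) + 1) {bitOf fun a => ∑ i ∈ I, ψ i a} := by
  classical
  induction I using Finset.induction_on with
  | empty =>
    convert extends_const (Φ := Φ) false using 2
    · simp
    · funext a; simp [bitOf]
  | insert x I hx ih =>
    rw [Finset.card_insert_of_notMem hx]
    refine ((((ih fun i hi => h i (Finset.mem_insert_of_mem hi)).union
      (h x (Finset.mem_insert_self _ _))).trans (extends_xor (φ := bitOf (ψ x))
      (ψ := bitOf fun a => ∑ i ∈ I, ψ i a) (by simp) (by simp))).mono subset_rfl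
      (by linarith) ?_)
    rw [← bitOf_add]
    simp [Finset.sum_insert hx]

variable {F : Type} [Field F] [Algebra (ZMod 2) F] {m : ℕ}

/-- The bits of a field-valued function with respect to the basis `b`. -/
def fieldBits (b : Module.Basis (Fin m) (ZMod 2) F) (y : (V → Bool) → F) :
    Set ((V → Bool) → Bool) :=
  Set.range fun u => bitOf fun a => b.repr (y a) u

theorem extends_fieldBits_add (b : Module.Basis (Fin m) (ZMod 2) F) {y y' : (V → Bool) → F}
    (h : fieldBits b y ⊆ Φ) (h' : fieldBits b y' ⊆ Φ) :
    Extends Φ (m * 4) (fieldBits b fun a => y a + y' a) := by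
  have := Extends.range (Φ := Φ) (s := 4) (fun u : Fin m => bitOf fun a => b.repr (y a + y' a) u)
    fun u => by
      simp only [map_add, Finsupp.add_apply]
      rw [bitOf_add]
      exact extends_xor (h ⟨u, rfl⟩) (h' ⟨u, rfl⟩)
  rwa [Fintype.card_fin] at this

/-- Bilinearity: the structure constants of the basis are fixed bits, which a circuit can hard-wire.
-/
theorem repr_mul (b : Module.Basis (Fin m) (ZMod 2) F) (y y' : F) (s : Fin m) :
    b.repr (y * y') s = ∑ q : Fin m × Fin m,
      b.repr (b q.1 * b q.2) s * (b.repr y q.1 * b.repr y' q.2) := by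
  conv_lhs => rw [← b.sum_repr y, ← b.sum_repr y', Finset.sum_mul_sum]
  simp only [map_sum, Finsupp.coe_finsetSum, Finset.sum_apply, Fintype.sum_prod_type,
    smul_mul_smul_comm, map_smul, Finsupp.smul_apply, smul_eq_mul]
  exact Finset.sum_congr rfl fun u _ => Finset.sum_congr rfl fun v _ => mul_comm _ _

theorem extends_fieldBits_mul (b : Module.Basis (Fin m) (ZMod 2) F) {y y' : (V → Bool) → F}
    (h : fieldBits b y ⊆ Φ) (h' : fieldBits b y' ⊆ Φ) :
    Extends Φ (m * (m * m * 7 + 1)) (fieldBits b fun a => y a * y' a) := by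
  have := Extends.range (Φ := Φ) (s := m * m * 7 + 1)
    (fun u : Fin m => bitOf fun a => b.repr (y a * y' a) u) fun u => by
      rw [show (fun a => b.repr (y a * y' a) u) = fun a => ∑ q : Fin m × Fin m,
        b.repr (b q.1 * b q.2) u * (b.repr (y a) q.1 * b.repr (y' a) q.2) from
        funext fun a => repr_mul b _ _ u]
      -- Three gates per term: the structure constant and two conjunctions. Adding the term costs
      -- four more, hence the `7`.
      have := extends_bitOf_sum (Φ := Φ) (s := 3) (Finset.univ : Finset (Fin m × Fin m))
        (fun q a => b.repr (b q.1 * b q.2) u * (b.repr (y a) q.1 * b.repr (y' a) q.2))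
        fun q _ => by
          rw [bitOf_mul (fun _ => b.repr (b q.1 * b q.2) u), bitOf_mul]
          refine (((extends_const (decide (b.repr (b q.1 * b q.2) u = 1))).union
            (extends_and (h ⟨q.1, rfl⟩) (h' ⟨q.2, rfl⟩))).trans (extends_and ?_ ?_)).mono
            subset_rfl le_rfl subset_rfl
          · exact Set.mem_union_right _ (Set.mem_union_left _ rfl)
          · simp
      simpa using this
  rwa [Fintype.card_fin] at this

/-- Horner's rule. -/
theorem extends_fieldBits_polyHash (b : Module.Basis (Fin m) (ZMod 2) F)
    {x : (V → Bool) → F} (hx : fieldBits b x ⊆ Φ) {κ : ℕ} : ∀ y : Fin κ → (V → Bool) → F,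
    (∀ i, fieldBits b (y i) ⊆ Φ) →
    Extends Φ (κ * (m * (m * m * 7 + 1) + m * 4) + m)
      (fieldBits b fun a => polyHash (x a) fun i => y i a) := by
  induction κ with
  | zero =>
    intro y _
    have := Extends.range (Φ := Φ) (s := 1) (fun _ : Fin m => fun _ : V → Bool => false)
      fun u => extends_const false
    rw [Fintype.card_fin, mul_one] at this
    simpa [fieldBits, polyHash, show (bitOf fun _ : V → Bool => 0) = fun _ => false from
      funext fun _ => by simp [bitOf]] using this
  | succ κ ih =>
    intro y hy
    -- The polynomial is its shifted tail times `x`, plus the coefficient `y 0`.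
    have h1 := ih (fun i => y i.succ) fun i => hy i.succ
    have h2 := h1.trans (extends_fieldBits_mul b Set.subset_union_right
      (hx.trans Set.subset_union_left))
    have h3 := h2.trans (extends_fieldBits_add b Set.subset_union_right
      ((hy 0).trans Set.subset_union_left))
    refine h3.mono subset_rfl (by linarith) (Eq.subset ?_)
    congr 1
    funext a
    simp only [polyHash, Fin.sum_univ_succ, Fin.val_zero, pow_zero, mul_one, Fin.val_succ,
      Finset.sum_mul]
    rw [add_comm]
    congr 1
    exact Finset.sum_congr rfl fun i _ => by ring

end Circuits

/-! ### The pseudorandom selection -/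

/-- The bijection between the truth values and the field of two elements. -/
def boolEquivZMod : Bool ≃ ZMod 2 where
  toFun b := if b then 1 else 0
  invFun x := decide (x = 1)
  left_inv := by decide
  right_inv := by decide

theorem decide_boolEquivZMod (b : Bool) : decide (boolEquivZMod b = 1) = b :=
  boolEquivZMod.left_inv b

theorem indexBits_injective (n : ℕ) : Function.Injective (indexBits (n := n)) := by
  intro i j h
  have hlt (i : Fin n) : (i : ℕ) < 2 ^ Nat.clog 2 n :=
    i.2.trans_le (Nat.le_pow_clog one_lt_two n)
  refine Fin.ext (Nat.eq_of_testBit_eq fun t => ?_)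
  by_cases ht : t < Nat.clog 2 n
  · exact congrFun h ⟨t, ht⟩
  · have h2 : 2 ^ Nat.clog 2 n ≤ 2 ^ t := Nat.pow_le_pow_right two_pos (not_lt.1 ht)
    rw [Nat.testBit_lt_two_pow ((hlt i).trans_le h2), Nat.testBit_lt_two_pow ((hlt j).trans_le h2)]

section Selection

variable {F : Type} [Field F] [Algebra (ZMod 2) F] {m : ℕ}

/-- The field element whose first `t` coordinates are given by `x`, the other ones being `0`. -/
noncomputable def bitsToField (b : Module.Basis (Fin m) (ZMod 2) F) {t : ℕ}
    (x : Fin t → Bool) : F :=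
  b.equivFun.symm fun u => if h : (u : ℕ) < t then boolEquivZMod (x ⟨u, h⟩) else 0

theorem repr_bitsToField (b : Module.Basis (Fin m) (ZMod 2) F) {t : ℕ} (x : Fin t → Bool)
    (u : Fin m) : b.repr (bitsToField b x) u =
      if h : (u : ℕ) < t then boolEquivZMod (x ⟨u, h⟩) else 0 := by
  rw [bitsToField, ← b.equivFun_apply, LinearEquiv.apply_symm_apply]

theorem bitsToField_injective (b : Module.Basis (Fin m) (ZMod 2) F) {t : ℕ} (ht : t ≤ m) :
    Function.Injective (bitsToField b (t := t)) := by
  intro x y h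
  funext u
  have := congrArg (fun e => b.repr e (Fin.castLE ht u)) h
  simpa [repr_bitsToField] using this

/-- Seeds as coefficient vectors. -/
noncomputable def seedEquiv (b : Module.Basis (Fin m) (ZMod 2) F) (κ : ℕ) :
    (Fin (κ * m) → Bool) ≃ (Fin κ → F) :=
  ((Equiv.arrowCongr finProdFinEquiv.symm boolEquivZMod).trans
    (Equiv.curry (Fin κ) (Fin m) (ZMod 2))).trans
    (Equiv.piCongrRight fun _ => b.equivFun.symm.toEquiv)

theorem repr_seedEquiv (b : Module.Basis (Fin m) (ZMod 2) F) (κ : ℕ) (z : Fin (κ * m) → Bool)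
    (i : Fin κ) (u : Fin m) :
    b.repr (seedEquiv b κ z i) u = boolEquivZMod (z (finProdFinEquiv (i, u))) := by
  have : seedEquiv b κ z i =
    b.equivFun.symm fun u => boolEquivZMod (z (finProdFinEquiv (i, u))) := rfl
  rw [this, ← b.equivFun_apply, LinearEquiv.apply_symm_apply]

/-- The selection of those indices at which the first `K` bits of the polynomial given by the seed
vanish. -/
noncomputable def hashSelection (b : Module.Basis (Fin m) (ZMod 2) F) (K κ n : ℕ)
    (z : Fin (κ * m) → Bool) (j : Fin n) : Bool :=
  decide (∀ u ∈ Finset.univ.filter (fun u : Fin m => (u : ℕ) < K),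
    (!decide (b.repr (polyHash (bitsToField b (indexBits j)) (seedEquiv b κ z)) u = 1)) = true)

theorem hashSelection_eq_true_iff (b : Module.Basis (Fin m) (ZMod 2) F) {K : ℕ} (hK : K ≤ m)
    (κ n : ℕ) (z : Fin (κ * m) → Bool) (j : Fin n) :
    hashSelection b K κ n z j = true ↔ (fun u : Fin K =>
      b.repr (polyHash (bitsToField b (indexBits j)) (seedEquiv b κ z)) (Fin.castLE hK u)) = 0 := by
  have h : ∀ x : ZMod 2, (!decide (x = 1)) = true ↔ x = 0 := by decide
  simp only [hashSelection, h, decide_eq_true_eq, Finset.mem_filter, Finset.mem_univ, true_and,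
    funext_iff, Pi.zero_apply]
  exact ⟨fun H u => H (Fin.castLE hK u) u.2, fun H u hu => H ⟨u, hu⟩⟩

/-- Since `2^m ≥ n`, distinct indices are distinct field points; the first `K` coordinates form an
additive surjection onto a group of order `2^K`. -/
theorem uniformProb_hashSelection [Fintype F] (b : Module.Basis (Fin m) (ZMod 2) F) {K κ n : ℕ}
    (hK : K ≤ m) (hn : Nat.clog 2 n ≤ m) (S : Finset (Fin n)) (hS : S.card ≤ κ) :
    uniformProb (fun z => ∀ j ∈ S, hashSelection b K κ n z j = true) =
      ((1 / 2 : ℝ) ^ K) ^ S.card := by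
  classical
  let π : F →+ (Fin K → ZMod 2) :=
    { toFun := fun y u => b.repr y (Fin.castLE hK u)
      map_zero' := by funext u; simp
      map_add' := fun x y => by funext u; simp }
  have hπ : Function.Surjective π := fun g => by
    refine ⟨b.equivFun.symm fun u => if h : (u : ℕ) < K then g ⟨u, h⟩ else 0, funext fun u => ?_⟩
    change b.repr _ _ = _
    rw [← b.equivFun_apply, LinearEquiv.apply_symm_apply]
    simp
  have hinj : Function.Injective fun j : Fin n => bitsToField b (indexBits j) :=
    (bitsToField_injective b hn).comp (indexBits_injective n)
  have hcard := Finset.card_image_of_injective S hinj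
  have h := uniformProb_polyHash π hπ (κ := κ)
    (S.image fun j : Fin n => bitsToField b (indexBits j)) (hcard.trans_le hS)
  rw [hcard, ← uniformProb_equiv (seedEquiv b κ), Fintype.card_fun, ZMod.card,
    Fintype.card_fin, Nat.cast_pow, Nat.cast_ofNat, ← one_div_pow] at h
  rw [← h]
  congr 1
  funext z
  simp only [Finset.forall_mem_image, hashSelection_eq_true_iff b hK]
  rfl

theorem exists_circuit_hashSelection (b : Module.Basis (Fin m) (ZMod 2) F) (K κ n : ℕ)
    (hm : 1 ≤ m) (hκ : 1 ≤ κ) :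
    ∃ C : BooleanCircuit (Fin (Nat.clog 2 n) ⊕ Fin (κ * m)), C.size ≤ 17 * (κ * m ^ 3) ∧
      ∀ (j : Fin n) (z : Fin (κ * m) → Bool),
        C.eval (Sum.elim (indexBits j) z) = hashSelection b K κ n z j := by
  classical
  let x : (Fin (Nat.clog 2 n) ⊕ Fin (κ * m) → Bool) → F := fun a => bitsToField b (a ∘ Sum.inl)
  let y : Fin κ → (Fin (Nat.clog 2 n) ⊕ Fin (κ * m) → Bool) → F :=
    fun i a => seedEquiv b κ (a ∘ Sum.inr) i
  let J := Finset.univ.filter (fun u : Fin m => (u : ℕ) < K)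
  have hx : Extends ∅ m (fieldBits b x) := by
    have := Extends.range (Φ := ∅) (s := 1) (fun u : Fin m => bitOf fun a => b.repr (x a) u)
      fun u => by
        by_cases hu : (u : ℕ) < Nat.clog 2 n
        · refine (extends_input (Sum.inl ⟨u, hu⟩)).mono subset_rfl zero_le_one (Eq.subset ?_)
          congr 1
          funext a
          simp [bitOf, x, repr_bitsToField, hu, decide_boolEquivZMod]
        · refine (extends_const false).mono subset_rfl le_rfl (Eq.subset ?_)
          congr 1
          funext a
          simp [bitOf, x, repr_bitsToField, hu]
    rwa [Fintype.card_fin, mul_one] at this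
  have hy : Extends (∅ : Set ((Fin (Nat.clog 2 n) ⊕ Fin (κ * m) → Bool) → Bool)) 0
      (⋃ i, fieldBits b (y i)) := by
    have := Extends.range (Φ := ∅) (s := 0)
      (fun q : Fin κ × Fin m => bitOf fun a => b.repr (y q.1 a) q.2) fun q => by
        refine (extends_input (Sum.inr (finProdFinEquiv q))).mono subset_rfl le_rfl (Eq.subset ?_)
        congr 1
        funext a
        simp [bitOf, y, repr_seedEquiv, decide_boolEquivZMod]
    refine this.mono subset_rfl (by simp) ?_
    refine Set.iUnion_subset fun i => ?_
    rintro _ ⟨u, rfl⟩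
    exact ⟨(i, u), rfl⟩
  have hh := (hx.union hy).trans (extends_fieldBits_polyHash b
    (Set.subset_union_left.trans Set.subset_union_right) y fun i =>
      ((Set.subset_iUnion (fun i => fieldBits b (y i)) i).trans
        Set.subset_union_right).trans Set.subset_union_right)
  have hneg := hh.trans (Extends.range (s := 1) (fun u : Fin m => fun a =>
    !(bitOf (fun a => b.repr (polyHash (x a) fun i => y i a) u) a)) fun u =>
      extends_not (Or.inr ⟨u, rfl⟩))
  have hall := hneg.trans (extends_all J (fun u : Fin m => fun a =>
    !(bitOf (fun a => b.repr (polyHash (x a) fun i => y i a) u) a)) fun u _ => Or.inr ⟨u, rfl⟩)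
  obtain ⟨C, hC, hCe⟩ := hall.exists_circuit
  refine ⟨C, hC.trans ?_, fun j z => ?_⟩
  -- The total is at most `7κm³ + 5κm + 4m + 1`, and `7 + 5 + 4 + 1 = 17`.
  · have hJ : J.card ≤ m := by simpa using Finset.card_le_univ J
    rw [Fintype.card_fin]
    have h1 : m ≤ m ^ 3 := Nat.le_self_pow (by norm_num) m
    have h2 : m ^ 3 ≤ κ * m ^ 3 := Nat.le_mul_of_pos_left _ hκ
    have h3 : κ * m ≤ κ * m ^ 3 := Nat.mul_le_mul_left _ h1
    have h4 : κ * (m * (m * m * 7 + 1) + m * 4) = 7 * (κ * m ^ 3) + 5 * (κ * m) := by ring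
    omega
  · rw [hCe]
    exact decide_eq_decide.2 Iff.rfl

end Selection

theorem exists_selection (n κ K m : ℕ) (hκ : 1 ≤ κ) (hm : 1 ≤ m) (hK : K ≤ m)
    (hn : Nat.clog 2 n ≤ m) :
    ∃ D : (Fin (κ * m) → Bool) → Fin n → Bool,
      (∀ S : Finset (Fin n), S.card ≤ κ →
        uniformProb (fun z => ∀ j ∈ S, D z j = true) = ((1 / 2 : ℝ) ^ K) ^ S.card) ∧
      ∃ C : BooleanCircuit (Fin (Nat.clog 2 n) ⊕ Fin (κ * m)), C.size ≤ 17 * (κ * m ^ 3) ∧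
        ∀ (j : Fin n) (z : Fin (κ * m) → Bool), C.eval (Sum.elim (indexBits j) z) = D z j := by
  have : Fact (Nat.Prime 2) := ⟨Nat.prime_two⟩
  let b := Module.finBasisOfFinrankEq (ZMod 2) (GaloisField 2 m)
    (GaloisField.finrank 2 (Nat.one_le_iff_ne_zero.1 hm))
  have : Fintype (GaloisField 2 m) := Fintype.ofFinite _
  exact ⟨hashSelection b K κ n, fun S hS => uniformProb_hashSelection b hK hn S hS,
    exists_circuit_hashSelection b K κ n hm hκ⟩

/-! ### Shrinkage -/

namespace ComparatorCircuit

/-- The number of wires that are labelled by the variable `i` or its negation. -/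
def weight {n : ℕ} (C : ComparatorCircuit (Fin n)) (i : Fin n) : ℕ :=
  (Finset.univ.filter fun w => (C.label w).1 = i).card

theorem card_filter_label {n : ℕ} (C : ComparatorCircuit (Fin n)) (P : Fin n → Prop)
    [DecidablePred P] :
    (Finset.univ.filter fun w => P (C.label w).1).card =
      ∑ i ∈ Finset.univ.filter P, C.weight i := by
  rw [Finset.card_eq_sum_card_fiberwise (f := fun w => (C.label w).1)
    (t := Finset.univ.filter P) fun w hw => by simpa using hw]
  refine Finset.sum_congr rfl fun i hi => ?_
  rw [weight, Finset.filter_filter]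
  congr 1
  ext w
  have := (Finset.mem_filter.1 hi).2
  simp only [Finset.mem_filter, Finset.mem_univ, true_and, and_iff_right_iff_imp]
  rintro rfl
  exact this

theorem sum_weight {n : ℕ} (C : ComparatorCircuit (Fin n)) : ∑ i, C.weight i = C.wires := by
  simpa using (C.card_filter_label fun _ => True).symm

theorem ofPair_eq_none_iff {n : ℕ} (σ β : Fin n → Bool) (i : Fin n) :
    Restriction.ofPair σ β i = none ↔ σ i = true := by
  simp [Restriction.ofPair]

theorem wireComplexity_ofPair_le {n : ℕ} (C : ComparatorCircuit (Fin n)) (σ β : Fin n → Bool) :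
    wireComplexity (restrict C.eval (Restriction.ofPair σ β)) ≤
      max 2 (∑ i ∈ Finset.univ.filter (fun i => σ i = true), C.weight i) := by
  have h := C.wireComplexity_restrict_le (Restriction.ofPair σ β)
  simp only [ofPair_eq_none_iff] at h
  rwa [C.card_filter_label fun i => σ i = true] at h

theorem wireComplexity_ofPair_le_expand {n : ℕ} (C : ComparatorCircuit (Fin n))
    (σ β : Fin n → Bool) (H : Finset (Fin n)) :
    wireComplexity (restrict C.eval (Restriction.ofPair σ β)) ≤
      2 ^ (H.filter fun i => σ i = true).card *
        (∑ i ∈ Hᶜ.filter (fun i => σ i = true), C.weight i + 2) := by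
  have h := C.wireComplexity_restrict_le_expand (Restriction.ofPair σ β) H
  simp only [ofPair_eq_none_iff] at h
  rw [C.card_filter_label fun i => i ∉ H ∧ σ i = true] at h
  convert h using 4
  ext i
  simp

end ComparatorCircuit

/-! ### Numerical estimates for the shrinkage bound. -/

theorem pow_ceil_le_two_rpow {q X : ℝ} (hq : 0 ≤ q) (hX : 0 ≤ X) (h : q ≤ 2 ^ (-X)) :
    q ^ ⌈X⌉₊ ≤ 2 ^ (-X ^ 2) := by
  refine (pow_le_pow_left₀ hq h _).trans ?_
  rw [← Real.rpow_natCast, ← Real.rpow_mul two_pos.le]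
  refine Real.rpow_le_rpow_of_exponent_le one_le_two ?_
  nlinarith [Nat.le_ceil X]

theorem two_pow_mul_lt_of_lt {X μ W : ℝ} {a : ℕ} (hX : 3 ≤ X) (hμ : 1 / 2 < μ) (hW : 0 ≤ W)
    (ha : (a : ℝ) ≤ X) (h : W < (X + 1) * (2 ^ X * μ)) :
    (2 : ℝ) ^ a * (W + 2) < 2 ^ (3 * X) * μ := by
  have h2a : (2 : ℝ) ^ a ≤ 2 ^ X := by
    rw [← Real.rpow_natCast]
    exact Real.rpow_le_rpow_of_exponent_le one_le_two ha
  have h3X : (2 : ℝ) ^ (3 * X) = 2 ^ X * 2 ^ X * 2 ^ X := by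
    rw [← Real.rpow_add two_pos, ← Real.rpow_add two_pos]
    congr 1; ring
  -- Bernoulli's inequality for `4^(X/2)`. The gap `2^X - (X + 1) ≥ 3/2` then absorbs the additive
  -- `2`.
  have hEX : 1 + 3 / 2 * X ≤ (2 : ℝ) ^ X := by
    have := one_add_mul_self_le_rpow_one_add (s := 3) (by norm_num) (p := X / 2) (by linarith)
    rw [show (1 : ℝ) + 3 = 2 ^ (2 : ℝ) by norm_num, ← Real.rpow_mul two_pos.le,
      show 2 * (X / 2) = X by ring] at this
    linarith
  rw [h3X]
  generalize (2 : ℝ) ^ X = E at *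
  have hE : 11 / 2 ≤ E := by linarith
  have h1 : (3 / 2 : ℝ) ≤ E - X - 1 := by linarith
  have h2 : (11 / 4 : ℝ) ≤ E * μ := by nlinarith
  have h3 : 3 / 2 * (11 / 4) ≤ (E - X - 1) * (E * μ) := by gcongr
  have h4 : W + 2 < E * (E * μ) := by linarith
  calc (2 : ℝ) ^ a * (W + 2) ≤ E * (W + 2) := by gcongr
    _ < E * (E * (E * μ)) := by gcongr
    _ = E * E * E * μ := by ring

/-! ### Concentration of the restricted wire complexity. -/

section Shrinkage

variable {Ω : Type} [Fintype Ω] [Nonempty Ω] {n κ : ℕ} (C : ComparatorCircuit (Fin n))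
  {D : Ω → Fin n → Bool} {p X : ℝ}

theorem mul_sum_weight_le (hp : 0 ≤ p) (U : Finset (Fin n)) :
    p * ∑ i ∈ U, (C.weight i : ℝ) ≤ p * C.wires := by
  rw [← C.sum_weight]
  push_cast
  refine mul_le_mul_of_nonneg_left ?_ hp
  exact Finset.sum_le_sum_of_subset_of_nonneg (Finset.subset_univ U) fun _ _ _ => by positivity

/-- The shrinkage bound for small deviations, from Markov's inequality. -/
theorem uniformProb_shrinkage_le_of_le_three (hp : 0 < p) (h1 : 1 ≤ X) (h3 : X ≤ 3)
    (hκ : 1 ≤ κ)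
    (hD : ∀ S : Finset (Fin n), S.card ≤ κ →
      uniformProb (fun z => ∀ i ∈ S, D z i = true) ≤ p ^ S.card)
    (hμ : 1 / 2 < p * C.wires) :
    uniformProb (fun ω : Ω × (Fin n → Bool) => (2 : ℝ) ^ (3 * X) * (p * C.wires) ≤
      (wireComplexity (restrict C.eval (Restriction.ofPair (D ω.1) ω.2)) : ℝ)) ≤
      2 * 2 ^ (-X ^ 2) := by
  have hsum : ∑ i, (C.weight i : ℝ) = C.wires := by exact_mod_cast C.sum_weight
  have hμ0 : 0 < p * C.wires := by linarith
  have h8 : (8 : ℝ) ≤ 2 ^ (3 * X) := by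
    calc (8 : ℝ) = 2 ^ (3 : ℝ) := by norm_num
      _ ≤ _ := Real.rpow_le_rpow_of_exponent_le one_le_two (by linarith)
  -- First moment, `k = 1`: the terms with `M` cancel, so any upper bound on the weights will do.
  have htail := uniformProb_weight_le (w := fun i => (C.weight i : ℝ)) (fun _ => by positivity)
    hp.le hD Finset.univ hκ (M := C.wires) (c := 2 ^ (3 * X) * (p * C.wires))
    (fun i hi => by
      rw [← hsum]
      exact Finset.single_le_sum (f := fun i => (C.weight i : ℝ))
        (fun _ _ => by positivity) hi) (by positivity) (by positivity)
  have hbound : (p * (∑ i, (C.weight i : ℝ)) / (2 ^ (3 * X) * (p * C.wires))) ^ 1 ≤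
      2 * 2 ^ (-X ^ 2) := by
    rw [pow_one, hsum, mul_comm ((2 : ℝ) ^ _), div_mul_cancel_left₀ hμ0.ne',
      ← Real.rpow_neg two_pos.le,
      show (2 : ℝ) * 2 ^ (-X ^ 2) = 2 ^ (1 + -X ^ 2) by rw [Real.rpow_add two_pos, Real.rpow_one]]
    -- Here `X ≤ 3` gives `X² ≤ 3X`.
    exact Real.rpow_le_rpow_of_exponent_le one_le_two (by nlinarith)
  refine le_trans ?_ ((uniformProb_fst (Ω' := Fin n → Bool) _).trans_le (htail.trans hbound))
  refine uniformProb_mono fun ω h => ?_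
  have hw' := h.trans (Nat.cast_le.2 (C.wireComplexity_ofPair_le (D ω.1) ω.2))
  push_cast at hw' ⊢
  rcases le_max_iff.1 hw' with h' | h'
  -- The threshold exceeds `8 · 1/2`, so the `2` in the maximum cannot reach it.
  · nlinarith
  · linarith

/-- The shrinkage bound for large deviations: with high probability few heavy variables stay
alive, and the circuit is expanded along these. -/
theorem uniformProb_shrinkage_le_of_three_le (hp : 0 < p) (h3 : 3 ≤ X) (hκ : ⌈X⌉₊ ≤ κ)
    (hD : ∀ S : Finset (Fin n), S.card ≤ κ →
      uniformProb (fun z => ∀ i ∈ S, D z i = true) ≤ p ^ S.card)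
    (hμ : 1 / 2 < p * C.wires) :
    uniformProb (fun ω : Ω × (Fin n → Bool) => (2 : ℝ) ^ (3 * X) * (p * C.wires) ≤
      (wireComplexity (restrict C.eval (Restriction.ofPair (D ω.1) ω.2)) : ℝ)) ≤
      2 * 2 ^ (-X ^ 2) := by
  have hX : 0 ≤ X := by linarith
  have hμ0 : 0 < p * C.wires := by linarith
  have hle := mul_sum_weight_le C hp.le
  have hkX : (⌈X⌉₊ : ℝ) < X + 1 := Nat.ceil_lt_add_one hX
  have hE0 : (0 : ℝ) < 2 ^ X := by positivity
  have hEinv : (2 : ℝ) ^ (-X) = 1 / 2 ^ X := by rw [Real.rpow_neg two_pos.le, one_div]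
  -- This threshold balances the two tails: `p |H| ≤ 2^(-X)` and `p · (light weight) / M ≤ 2^(-X)`.
  obtain ⟨M, hM⟩ : ∃ M, M = 2 ^ X * (p * C.wires) := ⟨_, rfl⟩
  have hM0 : 0 < M := by rw [hM]; positivity
  obtain ⟨H, hH⟩ : ∃ H : Finset (Fin n), ∀ i, i ∈ H ↔ M ≤ (C.weight i : ℝ) :=
    ⟨Finset.univ.filter fun i => M ≤ (C.weight i : ℝ), by simp⟩
  -- With unit weights the event is that at least `⌈X⌉` heavy variables are live.
  have hheavy := uniformProb_weight_le (w := fun _ : Fin n => (1 : ℝ)) (fun _ => zero_le_one)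
    hp.le hD H hκ (M := 1) (c := 1) (fun _ _ => le_rfl) zero_le_one one_pos
  have hlight := uniformProb_weight_le (w := fun i => (C.weight i : ℝ)) (fun _ => by positivity)
    hp.le hD Hᶜ hκ (M := M) (c := M)
    (fun i hi => (not_le.1 fun h => Finset.mem_compl.1 hi ((hH i).2 h)).le) hM0.le hM0
  have hheavy' : (p * (∑ _i ∈ H, (1 : ℝ)) / 1) ^ ⌈X⌉₊ ≤ 2 ^ (-X ^ 2) := by
    refine pow_ceil_le_two_rpow (by positivity) hX ?_
    rw [hEinv, div_one, le_div_iff₀ hE0]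
    have h1 : (∑ _i ∈ H, (1 : ℝ)) * M ≤ ∑ i ∈ H, (C.weight i : ℝ) := by
      rw [Finset.sum_mul]
      exact Finset.sum_le_sum fun i hi => by simpa using (hH i).1 hi
    have h2 := (mul_le_mul_of_nonneg_left h1 hp.le).trans (hle H)
    refine le_of_mul_le_mul_right (a := p * C.wires) ?_ hμ0
    rw [hM] at h2
    linarith
  have hlight' : (p * (∑ i ∈ Hᶜ, (C.weight i : ℝ)) / M) ^ ⌈X⌉₊ ≤ 2 ^ (-X ^ 2) := by
    refine pow_ceil_le_two_rpow (by positivity) hX ?_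
    rw [hEinv, div_le_div_iff₀ hM0 hE0, hM, one_mul, mul_comm]
    exact mul_le_mul_of_nonneg_left (hle Hᶜ) hE0.le
  refine le_trans ?_ ((add_le_add (hheavy.trans hheavy') (hlight.trans hlight')).trans
    (two_mul _).ge)
  refine le_trans ?_ (uniformProb_or_le _ _)
  refine le_trans ?_ (uniformProb_fst (Ω' := Fin n → Bool) _).le
  refine uniformProb_mono fun ω h => ?_
  by_contra hcon
  rw [not_or, not_le, not_le] at hcon
  obtain ⟨hc1, hc2⟩ := hcon
  have hw := h.trans (Nat.cast_le.2 (C.wireComplexity_ofPair_le_expand (D ω.1) ω.2 H))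
  push_cast at hw
  refine absurd hw (not_le.2 (two_pow_mul_lt_of_lt h3 hμ
    (Finset.sum_nonneg fun _ _ => by positivity) ?_ ?_))
  · have h1 : (H.filter fun i => D ω.1 i = true).card < ⌈X⌉₊ := by
      simp only [Finset.sum_const, nsmul_eq_mul, mul_one] at hc1
      exact_mod_cast (by linarith :
        ((H.filter fun i => D ω.1 i = true).card : ℝ) < ⌈X⌉₊)
    exact (Nat.lt_ceil.1 h1).le
  · rw [← hM]
    nlinarith

theorem uniformProb_shrinkage_le (hp : 0 < p) (hX : 0 ≤ X) (hκ : ⌈X⌉₊ + 1 ≤ κ)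
    (hD : ∀ S : Finset (Fin n), S.card ≤ κ →
      uniformProb (fun z => ∀ i ∈ S, D z i = true) ≤ p ^ S.card)
    (hμ : 1 / 2 < p * C.wires) :
    uniformProb (fun ω : Ω × (Fin n → Bool) => (2 : ℝ) ^ (3 * X) * (p * C.wires) ≤
      (wireComplexity (restrict C.eval (Restriction.ofPair (D ω.1) ω.2)) : ℝ)) ≤
      2 * 2 ^ (-X ^ 2) := by
  rcases lt_or_ge X 1 with h1 | h1
  -- For `X < 1` the right-hand side is at least `1`.
  · refine (uniformProb_le_one _).trans ?_
    have : (2 : ℝ) ^ (-1 : ℝ) ≤ 2 ^ (-X ^ 2) :=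
      Real.rpow_le_rpow_of_exponent_le one_le_two (by nlinarith)
    rw [Real.rpow_neg_one] at this
    linarith
  rcases le_total X 3 with h3 | h3
  · exact uniformProb_shrinkage_le_of_le_three C hp h1 h3 (by omega) hD hμ
  · exact uniformProb_shrinkage_le_of_three_le C hp h3 (by omega) hD hμ

end Shrinkage

/-! ### Choice of parameters and the main theorem. -/

theorem selectionRate_mul_gt {l : ℕ} (hl : 1 ≤ l) : 1 / 2 < selectionRate l * l := by
  have hl' : (1 : ℝ) ≤ l := by exact_mod_cast hl
  have hL : 0 ≤ Real.logb 2 (l : ℝ) := Real.logb_nonneg one_lt_two hl'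
  set L := Real.logb 2 (l : ℝ) with hLdef
  have h2 : (l : ℝ) = 2 ^ L := (Real.rpow_logb two_pos (by norm_num) (by linarith)).symm
  have hceil := Nat.ceil_lt_add_one (show 0 ≤ 2 / 3 * L by positivity)
  have hrate : selectionRate l = 2 ^ (-(⌈2 / 3 * L⌉₊ : ℝ)) := by
    rw [selectionRate, ← hLdef, one_div_pow, Real.rpow_neg two_pos.le, Real.rpow_natCast, one_div]
  rw [hrate, show (1 / 2 : ℝ) = 2 ^ (-1 : ℝ) by rw [Real.rpow_neg_one, one_div]]
  refine lt_of_lt_of_eq ?_ (congrArg _ h2.symm)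
  rw [← Real.rpow_add two_pos]
  -- Rounding loses less than a factor `2`, so `pℓ > ℓ^(1/3) / 2 ≥ 1/2`.
  exact Real.rpow_lt_rpow_of_exponent_lt one_lt_two (by linarith)

/-- The place where `ℓ ≥ n^ε` is needed: indices have `O(log ℓ)` bits, which bounds the degree of
the field. -/
theorem clog_le_of_rpow_le {n l : ℕ} {ε : ℝ} (hε : 0 < ε) (hn : 1 ≤ n)
    (h : (n : ℝ) ^ ε ≤ l) : (Nat.clog 2 n : ℝ) ≤ 1 / ε * Real.logb 2 l + 1 := by
  have hn' : (1 : ℝ) ≤ n := by exact_mod_cast hn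
  have h0 : 0 < (n : ℝ) ^ ε := Real.rpow_pos_of_pos (by linarith) ε
  have h1 : Real.logb 2 ((n : ℝ) ^ ε) ≤ Real.logb 2 l := Real.logb_le_logb_of_le one_lt_two h0 h
  rw [Real.logb_rpow_eq_mul_logb_of_pos (by linarith)] at h1
  have h2 := Nat.ceil_lt_add_one (Real.logb_nonneg one_lt_two hn')
  have h3 : ⌈Real.logb 2 (n : ℝ)⌉₊ = Nat.clog 2 n := by
    exact_mod_cast Real.natCeil_logb_natCast 2 n
  rw [h3] at h2
  have h4 : Real.logb 2 (n : ℝ) ≤ 1 / ε * Real.logb 2 l := by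
    rw [one_div, ← div_eq_inv_mul, le_div_iff₀ hε]
    linarith
  linarith

theorem mainTheorem6 (c ε : ℝ) (hc : 0 < c) (hε : 0 < ε) :
    ∃ A : ℕ, ∀ (n : ℕ) (f : (Fin n → Bool) → Bool) (l : ℕ) (p : ℝ), 1 ≤ n →
      l = wireComplexity f → (n : ℝ) ^ ε ≤ (l : ℝ) → p = selectionRate l →
      ∃ (r : ℕ) (D : (Fin r → Bool) → Fin n → Bool),
        (r : ℝ) ≤ A * (Real.logb 2 l + 1) ^ A ∧
        IsRegularSelection p D ∧
        uniformProb (fun ω : (Fin r → Bool) × (Fin n → Bool) =>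
            (2 : ℝ) ^ (3 * √(c * Real.logb 2 l)) * (p * l) ≤
              (wireComplexity (restrict f (Restriction.ofPair (D ω.1) ω.2)) : ℝ)) ≤
          2 * (l : ℝ) ^ (-c) ∧
        ∃ C : BooleanCircuit (Fin (Nat.clog 2 n) ⊕ Fin r),
          (C.size : ℝ) ≤ A * (Real.logb 2 l + 1) ^ A ∧
          ∀ (j : Fin n) (z : Fin r → Bool), C.eval (Sum.elim (indexBits j) z) = D z j := by
  -- Chosen so that both `κ` and `m` are at most `B (log ℓ + 1)`; then `17 κ m³ ≤ 17 B⁴ (log ℓ +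
  -- 1)⁴`. The extra `4` in `A` makes it a valid exponent too.
  obtain ⟨B, hB⟩ := exists_nat_ge (1 / ε + c + 3)
  have hεinv : 0 < 1 / ε := by positivity
  refine ⟨17 * B ^ 4 + 4, fun n f l p hn hl hnl hp => ?_⟩
  have hn' : (1 : ℝ) ≤ n := by exact_mod_cast hn
  have hl1 : (1 : ℝ) ≤ l := (Real.one_le_rpow hn' hε.le).trans hnl
  have hl1' : 1 ≤ l := by exact_mod_cast hl1
  obtain ⟨C₀, hC₀, rfl⟩ : ∃ C : ComparatorCircuit (Fin n), C.wires = l ∧ C.eval = f := by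
    -- The infimum of the empty set is `0`, so `ℓ ≥ 1` yields an optimal circuit.
    have hpos : 0 < sInf {m : ℕ | ∃ C : ComparatorCircuit (Fin n), C.wires = m ∧ C.eval = f} := by
      change 0 < wireComplexity f
      omega
    rw [hl]
    exact Nat.sInf_mem (Nat.nonempty_of_pos_sInf hpos)
  clear hl
  subst hC₀
  set l := C₀.wires
  have hclog := clog_le_of_rpow_le hε hn hnl
  have hL : 0 ≤ Real.logb 2 (l : ℝ) := Real.logb_nonneg one_lt_two hl1
  set L := Real.logb 2 (l : ℝ) with hLdef
  set X := √(c * L) with hX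
  have hX0 : 0 ≤ X := Real.sqrt_nonneg _
  have hX2 : X ^ 2 = c * L := Real.sq_sqrt (by positivity)
  set K := ⌈(2 / 3 : ℝ) * L⌉₊ with hK
  have hpK : p = (1 / 2) ^ K := hp
  have hp0 : 0 < p := by rw [hpK]; positivity
  -- Room for the index bits and for the `K` tested bits; the `1` keeps the degree positive.
  set m := Nat.clog 2 n + K + 1 with hm
  obtain ⟨D, hD, C, hCsize, hC⟩ :=
    exists_selection n (⌈X⌉₊ + 1) K m (by omega) (by omega) (by omega) (by omega)
  rw [← hpK] at hD
  have hT : 1 ≤ L + 1 := by linarith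
  have hκB : ((⌈X⌉₊ + 1 : ℕ) : ℝ) ≤ B * (L + 1) := by
    have := Nat.ceil_lt_add_one hX0
    have h1 : X ≤ c * L + 1 := by nlinarith
    have h2 : (1 / ε + c + 3) * (L + 1) ≤ B * (L + 1) := by gcongr
    have h3 : 0 ≤ 1 / ε * L := by positivity
    push_cast
    linarith
  have hmB : (m : ℝ) ≤ B * (L + 1) := by
    have := Nat.ceil_lt_add_one (show 0 ≤ 2 / 3 * L by positivity)
    have h2 : (1 / ε + c + 3) * (L + 1) ≤ B * (L + 1) := by gcongr
    have h3 : 0 ≤ c * L := by positivity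
    rw [hm]
    push_cast
    linarith
  have hB1 : (1 : ℝ) ≤ B := by linarith
  have hsize : (17 * ((⌈X⌉₊ + 1 : ℕ) * m ^ 3) : ℝ) ≤
      ((17 * B ^ 4 + 4 : ℕ) : ℝ) * (L + 1) ^ (17 * B ^ 4 + 4) := by
    calc (17 * ((⌈X⌉₊ + 1 : ℕ) * m ^ 3) : ℝ)
        ≤ 17 * ((B * (L + 1)) * (B * (L + 1)) ^ 3) := by gcongr
      _ = (17 * B ^ 4) * (L + 1) ^ 4 := by ring
      _ ≤ ((17 * B ^ 4 + 4 : ℕ) : ℝ) * (L + 1) ^ (17 * B ^ 4 + 4) := by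
        push_cast
        gcongr ?_ * ?_
        · linarith
        · exact pow_le_pow_right₀ hT (by omega)
  refine ⟨(⌈X⌉₊ + 1) * m, D, ?_, fun i => ?_, ?_, C, ?_, hC⟩
  · refine le_trans ?_ hsize
    have h1 : (1 : ℝ) ≤ m := by exact_mod_cast (show 1 ≤ m by omega)
    have h2 : (m : ℝ) ≤ m ^ 3 := le_self_pow₀ h1 (by norm_num)
    rw [Nat.cast_mul]
    have h3 : ((⌈X⌉₊ + 1 : ℕ) : ℝ) * m ≤ (⌈X⌉₊ + 1 : ℕ) * (m : ℝ) ^ 3 := by gcongr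
    have h4 : (0 : ℝ) ≤ ((⌈X⌉₊ + 1 : ℕ) : ℝ) * (m : ℝ) ^ 3 := by positivity
    linarith
  -- Regularity is the case of singletons, available since `κ = ⌈X⌉ + 1 ≥ 1` even if `X = 0`.
  · simpa using hD {i} (by simp)
  · have h := uniformProb_shrinkage_le C₀ hp0 hX0 le_rfl (fun S hS => (hD S hS).le)
      (by rw [hp]; exact selectionRate_mul_gt hl1')
    have hlc : (l : ℝ) ^ (-c) = 2 ^ (-X ^ 2) := by
      rw [hX2, show -(c * L) = L * -c by ring, Real.rpow_mul two_pos.le, hLdef,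
        Real.rpow_logb two_pos (by norm_num) (by linarith)]
    rwa [hlc]
  · exact le_trans (by exact_mod_cast hCsize) hsize
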